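/- Let $M$ be a smooth manifold of dimension $n\ge 2$, let $\mathcal TM = TM\setminus\{0\}$ be its slit tangent bundle with induced coordinates $(x^i,y^i)$, let $\mathcal C=y^i\partial/\partial y^i$ be the Liouville vector field and $J=\frac{\partial}{\partial y^i}\otimes dx^i$ the natural almost-tangent structure. A *spray* is a smooth vector field $S$ on $\mathcal TM$ with $JS=\mathcal C$ and $[\mathcal C,S]=S$; locally $S=y^i\frac{\partial}{\partial x^i}-2G^i(x,y)\frac{\partial}{\partial y^i}$. A *Finsler function* is a continuous function $F:TM\to\mathbb R$ that is smooth and strictly positive on $\mathcal TM$, zero exactly on the zero section, positively homogeneous of degree $1$ in $y$, and whose metric tensor $g_{ij}=\frac12\frac{\partial^2F^2}{\partial y^i\partial y^j}$ has maximal rank on $\mathcal TM$. A spray $S$ is *Finsler metrizable* if there is a Finsler function $F$ whose geodesic spray is $S$, i.e. $i_S\,dd_J\mathcal E=-d\mathcal E$ on $\mathcal TM$ for the energy $\mathcal E=\frac12F^2$. A function $\mathcal P$ is *holonomy invariant* with respect to $S$ if $\mathcal P(\tau(v))=\mathcal P(v)$ for every $v\in\mathcal TM$ and every parallel translation $\tau$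 along a curve in $M$, with respect to the nonlinear connection of $S$, whose horizontal spaces are spanned by $\delta_i=\frac{\partial}{\partial x^i}-\frac{\partial G^j}{\partial y^i}\frac{\partial}{\partial y^j}$. **Theorem.** Let $S$ be a Finsler metrizable spray on $M$, and let $\mathcal P:\mathcal TM\to\mathbb R$ be a smooth, positively $1$-homogeneous function that is holonomy invariant with respect to $S$ and nontrivial (not identically zero). Then for (Lebesgue-)almost every $\lambda\in\mathbb R$ the projective deformation $\widetilde S=S-2\lambda\mathcal P\,\mathcal C$ is not Finsler metrizable. -/

import Mathlib

open Set Bundle MeasureTheory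
open scoped Manifold ContDiff

noncomputable section

namespace FinslerSpray

variable {E : Type*} [NormedAddCommGroup E] [NormedSpace ℝ E]
variable {M : Type*} [TopologicalSpace M] [ChartedSpace E M] [IsManifold 𝓘(ℝ, E) ∞ M]

/-- The slit tangent bundle, i.e. the set of nonzero tangent vectors, as a subset of `TM`. -/
def slit (E : Type*) [NormedAddCommGroup E] [NormedSpace ℝ E]
    (M : Type*) [TopologicalSpace M] [ChartedSpace E M] [IsManifold 𝓘(ℝ, E) ∞ M] :
    Set (TangentBundle 𝓘(ℝ, E) M) :=
  {v | v.2 ≠ 0}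

/-- Vector fields on `TM`. Only their values on the slit tangent bundle will matter. -/
abbrev TField (E : Type*) [NormedAddCommGroup E] [NormedSpace ℝ E]
    (M : Type*) [TopologicalSpace M] [ChartedSpace E M] [IsManifold 𝓘(ℝ, E) ∞ M] : Type _ :=
  (v : TangentBundle 𝓘(ℝ, E) M) → TangentSpace 𝓘(ℝ, E).tangent v

/-- The vertical lift of `w ∈ T_xM` at `v ∈ T_xM`: the velocity at `t = 0` of `t ↦ v + t w`. -/
def verticalLift (v : TangentBundle 𝓘(ℝ, E) M) (w : TangentSpace 𝓘(ℝ, E) v.proj) :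
    TangentSpace 𝓘(ℝ, E).tangent v :=
  let γ : ℝ → TangentBundle 𝓘(ℝ, E) M := fun t => ⟨v.proj, v.2 + t • w⟩
  (mfderiv 𝓘(ℝ, ℝ) 𝓘(ℝ, E).tangent γ 0 : ℝ →L[ℝ] (E × E)) 1

/-- The natural almost-tangent structure `J = ∂/∂yⁱ ⊗ dxⁱ`: the vertical lift of the projection
of a vector to the base. -/
def almostTangent (v : TangentBundle 𝓘(ℝ, E) M) (ξ : TangentSpace 𝓘(ℝ, E).tangent v) :
    TangentSpace 𝓘(ℝ, E).tangent v :=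
  verticalLift v
    (mfderiv 𝓘(ℝ, E).tangent 𝓘(ℝ, E) (fun u : TangentBundle 𝓘(ℝ, E) M => u.proj) v ξ)

/-- The Liouville vector field `C = yⁱ ∂/∂yⁱ`. -/
def liouville : TField E M := fun v => verticalLift v v.2

/-- A spray: a smooth vector field on the slit tangent bundle with `JS = C` and `[C, S] = S`. -/
structure IsSpray (S : TField E M) : Prop where
  smooth : ContMDiffOn 𝓘(ℝ, E).tangent 𝓘(ℝ, E).tangent.tangent ∞
    (fun v => (⟨v, S v⟩ : TangentBundle 𝓘(ℝ, E).tangent (TangentBundle 𝓘(ℝ, E) M))) (slit E M)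
  almostTangent_eq : ∀ v ∈ slit E M, almostTangent v (S v) = liouville v
  bracket_eq : ∀ v ∈ slit E M,
    VectorField.mlieBracket 𝓘(ℝ, E).tangent liouville S v = S v

/-- The projective deformation `S - 2 Q C` of `S` with projective factor `Q`. -/
def projDeform (S : TField E M) (Q : TangentBundle 𝓘(ℝ, E) M → ℝ) : TField E M :=
  fun v => S v - (2 * Q v) • liouville v

/-! ### Induced coordinates `(x, y)` on `TM` -/

/-- The chart `(x, y)` of `TM` induced by the chart `x` of `M` around `p`. -/
def tchart (E : Type*) [NormedAddCommGroup E] [NormedSpace ℝ E]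
    {M : Type*} [TopologicalSpace M] [ChartedSpace E M] [IsManifold 𝓘(ℝ, E) ∞ M] (p : M) :
    PartialEquiv (TangentBundle 𝓘(ℝ, E) M) (E × E) :=
  extChartAt 𝓘(ℝ, E).tangent (⟨p, 0⟩ : TangentBundle 𝓘(ℝ, E) M)

/-- A function on `TM` written in the induced coordinates around `p`. -/
def localFun (p : M) (f : TangentBundle 𝓘(ℝ, E) M → ℝ) : E × E → ℝ :=
  fun z => f ((tchart E p).symm z)

/-- The components, in the induced coordinates around `p`, of a vector tangent to `TM` at `v`. -/
def components (p : M) (v : TangentBundle 𝓘(ℝ, E) M) (ξ : TangentSpace 𝓘(ℝ, E).tangent v) :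
    E × E :=
  (mfderiv 𝓘(ℝ, E).tangent 𝓘(ℝ, E × E) (tchart E p) v : (E × E) →L[ℝ] (E × E)) ξ

/-- The spray coefficients in the induced coordinates around `p`:
`S = yⁱ ∂/∂xⁱ - 2 Gⁱ ∂/∂yⁱ`. -/
def sprayCoeff (p : M) (S : TField E M) : E × E → E :=
  fun z => (-(1 / 2 : ℝ)) •
    (components p ((tchart E p).symm z) (S ((tchart E p).symm z))).2

/-! ### Finsler functions and metrizability -/

/-- The `1`-form `d_J f = (∂f/∂yⁱ) dxⁱ` of a function on `E × E`. -/
def dJ (f : E × E → ℝ) : E × E → (E × E) →L[ℝ] ℝ :=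
  fun z => (fderiv ℝ f z).comp
    ((ContinuousLinearMap.inr ℝ E E).comp (ContinuousLinearMap.fst ℝ E E))

/-- The exterior derivative of a `1`-form on `E × E`. -/
def extD (α : E × E → (E × E) →L[ℝ] ℝ) (z X Y : E × E) : ℝ :=
  (fderiv ℝ α z X) Y - (fderiv ℝ α z Y) X

/-- The energy function `½ F²`. -/
def energy (F : TangentBundle 𝓘(ℝ, E) M → ℝ) : TangentBundle 𝓘(ℝ, E) M → ℝ :=
  fun v => (1 / 2) * F v ^ 2

/-- The metric tensor `g_{ij} = ½ ∂²F²/∂yⁱ∂yʲ` in the induced coordinates around `p`, as a bilinear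
form evaluated at `u, w`. -/
def metricTensor (p : M) (F : TangentBundle 𝓘(ℝ, E) M → ℝ) (z : E × E) (u w : E) : ℝ :=
  (fderiv ℝ (fderiv ℝ (localFun p (energy F))) z ((0 : E), u)) ((0 : E), w)

/-- Finsler functions. -/
structure IsFinsler (F : TangentBundle 𝓘(ℝ, E) M → ℝ) : Prop where
  continuous : Continuous F
  smooth : ContMDiffOn 𝓘(ℝ, E).tangent 𝓘(ℝ, ℝ) ∞ F (slit E M)
  pos : ∀ v ∈ slit E M, 0 < F v
  zero : ∀ x : M, F ⟨x, 0⟩ = 0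
  homogeneous : ∀ (x : M) (y : TangentSpace 𝓘(ℝ, E) x) (c : ℝ), 0 < c →
    F ⟨x, c • y⟩ = c * F ⟨x, y⟩
  nondegenerate : ∀ (p : M), ∀ v ∈ (tchart E p).source, v ∈ slit E M →
    ∀ u : E, (∀ w : E, metricTensor p F (tchart E p v) u w = 0) → u = 0

/-- `S` satisfies the Euler-Lagrange equation `i_S d d_J 𝓔 = -d𝓔` for the energy `𝓔` of `F`
on the slit tangent bundle. For a Finsler function `F` this determines `S` there, and says that `S`
is the geodesic spray of `F`. -/
def IsGeodesicSpray (F : TangentBundle 𝓘(ℝ, E) M → ℝ) (S : TField E M) : Prop :=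
  ∀ (p : M), ∀ v ∈ (tchart E p).source, v ∈ slit E M → ∀ Z : E × E,
    extD (dJ (localFun p (energy F))) (tchart E p v) (components p v (S v)) Z
      = - fderiv ℝ (localFun p (energy F)) (tchart E p v) Z

/-- `S` is Finsler metrizable: it is the geodesic spray of some Finsler function. -/
def FinslerMetrizable (S : TField E M) : Prop :=
  ∃ F : TangentBundle 𝓘(ℝ, E) M → ℝ, IsFinsler F ∧ IsGeodesicSpray F S

/-! ### Parallel translation and holonomy invariance -/

/-- `ξ ∈ T_v(TM)` is horizontal for the nonlinear connection of `S`: in induced coordinates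
`ξ = aⁱ δ_i`, `δ_i = ∂/∂xⁱ - Gʲ_i ∂/∂yʲ` with `Gʲ_i = ∂Gʲ/∂yⁱ`. For a spray this does not depend on
the chart chosen around the base point of `v`. -/
def IsHorizontal (S : TField E M) (v : TangentBundle 𝓘(ℝ, E) M)
    (ξ : TangentSpace 𝓘(ℝ, E).tangent v) : Prop :=
  ∃ p : M, v ∈ (tchart E p).source ∧
    (components p v ξ).2 =
      - fderiv ℝ (sprayCoeff p S) (tchart E p v) ((0 : E), (components p v ξ).1)

/-- `γ` is, on the open interval `(a, b)`, a nowhere zero parallel vector field along a smooth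
curve of `M` (the curve `t ↦ (γ t).proj`), i.e. a horizontal lift of that curve. -/
structure IsParallel (S : TField E M) (γ : ℝ → TangentBundle 𝓘(ℝ, E) M) (a b : ℝ) : Prop where
  smooth_base : ContMDiffOn 𝓘(ℝ, ℝ) 𝓘(ℝ, E) ∞ (fun t => (γ t).proj) (Ioo a b)
  differentiable : ∀ t ∈ Ioo a b, MDifferentiableAt 𝓘(ℝ, ℝ) 𝓘(ℝ, E).tangent γ t
  mem_slit : ∀ t ∈ Ioo a b, γ t ∈ slit E M
  horizontal : ∀ t ∈ Ioo a b, IsHorizontal S (γ t)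
    ((mfderiv 𝓘(ℝ, ℝ) 𝓘(ℝ, E).tangent γ t : ℝ →L[ℝ] (E × E)) 1)

/-- `P` is invariant under parallel translation: `P(τ(v)) = P(v)` whenever `τ` is the parallel
translation along a smooth curve from parameter `s` to parameter `t`, and `v = γ s`, `τ(v) = γ t`
with `γ` parallel along that curve. -/
def HolonomyInvariant (S : TField E M) (P : TangentBundle 𝓘(ℝ, E) M → ℝ) : Prop :=
  ∀ (γ : ℝ → TangentBundle 𝓘(ℝ, E) M) (a b : ℝ), IsParallel S γ a b →
    ∀ s ∈ Ioo a b, ∀ t ∈ Ioo a b, P (γ t) = P (γ s)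

end FinslerSpray

end

/-! The claim is local. In an induced chart, on an open set where `P` is nonzero, let `G` be the
coefficients of `S` and write `δ_a` for the horizontal and `∂_a` for the vertical derivative along
`a`. Holonomy invariance gives `δ_a P = 0` (`fderiv_localFun_horLift_eq_zero`). If the deformed
spray, with coefficients `G + l P y`, has energy `L`, then `L` is killed by the deformed horizontal
lifts (`fderiv_energy_horLift`). In terms of `G` this says `δ_a L = l (P ∂_a L + 2 L ∂_a P)`.

For the 0-homogeneous function `u = ½ log L - log |P|` this becomes `δ_a u = l (P ∂_a u + 2 ∂_a P)`.
Commuting `δ_y` with `δ_b` shows that the vertical differential of `u`, if nonzero, is an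
eigenvector of the transposed Jacobi endomorphism with eigenvalue `l² P²` (`fderiv_jacobi_eq`). At
one point this allows finitely many `l`, so over a countable dense set of points only countably many
`l` are lost. For every other `l`, continuity makes `u` constant along the fibres.

For such `l ≠ 0` the equation reads `∂u/∂x^a = 2 l ∂_a P`, whose vertical derivative is `∂_a ∂_b P =
0`. So along the fibres `P` is affine and `L` is proportional to `P²`. In dimension at least 2 the
fibre Hessian of `L` is then degenerate, contradicting regularity of the Finsler function. -/

noncomputable section

namespace FinslerSpray

/-! ### Differentiating first derivatives of a C² map -/

section LocalCalculus

variable {E : Type*} [NormedAddCommGroup E] [NormedSpace ℝ E]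

/-- The horizontal lift `aⁱ δ_i` for the nonlinear connection with spray coefficients `G`. -/
def horLift (G : E × E → E) (z : E × E) (a : E) : E × E :=
  (a, -fderiv ℝ G z ((0 : E), a))

/-- The curvature `R(a, b)` of the nonlinear connection with spray coefficients `G`. -/
def connCurvature (G : E × E → E) (z : E × E) (a b : E) : E :=
  fderiv ℝ (fderiv ℝ G) z (horLift G z a) ((0 : E), b)
    - fderiv ℝ (fderiv ℝ G) z (horLift G z b) ((0 : E), a)

variable {V : Type*} [NormedAddCommGroup V] [NormedSpace ℝ V]
variable {X : Type*} [NormedAddCommGroup X] [NormedSpace ℝ X]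
variable {U : Set X} {z : X}

lemma differentiableAt_of_contDiffOn {f : X → V} (hf : ContDiffOn ℝ 2 f U) (hU : IsOpen U)
    (hz : z ∈ U) : DifferentiableAt ℝ f z :=
  (hf.contDiffAt (hU.mem_nhds hz)).differentiableAt (by norm_num)

lemma differentiableAt_fderiv_of_contDiffOn {f : X → V} (hf : ContDiffOn ℝ 2 f U) (hU : IsOpen U)
    (hz : z ∈ U) : DifferentiableAt ℝ (fderiv ℝ f) z :=
  ((hf.contDiffAt (hU.mem_nhds hz)).fderiv_right (m := 1) (by norm_num)).differentiableAt
    (by norm_num)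

lemma fderiv_fderiv_comm {f : X → V} (hf : ContDiffOn ℝ 2 f U) (hU : IsOpen U) (hz : z ∈ U)
    (a b : X) : fderiv ℝ (fderiv ℝ f) z a b = fderiv ℝ (fderiv ℝ f) z b a :=
  ((hf.contDiffAt (hU.mem_nhds hz)).isSymmSndFDerivAt (by simp)).eq a b

lemma hasFDerivAt_fderiv_apply {f : X → V} (hf : ContDiffOn ℝ 2 f U) (hU : IsOpen U)
    (hz : z ∈ U) {c : X → X} {c' : X →L[ℝ] X} (hc : HasFDerivAt c c' z) :
    HasFDerivAt (fun w => fderiv ℝ f w (c w))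
      ((fderiv ℝ f z).comp c' + (fderiv ℝ (fderiv ℝ f) z).flip (c z)) z :=
  (differentiableAt_fderiv_of_contDiffOn hf hU hz).hasFDerivAt.clm_apply hc

lemma fderiv_fderiv_const_apply {f : X → V} (hf : ContDiffOn ℝ 2 f U) (hU : IsOpen U)
    (hz : z ∈ U) (b x : X) :
    fderiv ℝ (fun w => fderiv ℝ f w b) z x = fderiv ℝ (fderiv ℝ f) z x b := by
  rw [(hasFDerivAt_fderiv_apply hf hU hz (hasFDerivAt_const b z)).fderiv]
  simp

lemma differentiableAt_fderiv_const_apply {f : X → V} (hf : ContDiffOn ℝ 2 f U) (hU : IsOpen U)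
    (hz : z ∈ U) (b : X) : DifferentiableAt ℝ (fun w => fderiv ℝ f w b) z :=
  (hasFDerivAt_fderiv_apply hf hU hz (hasFDerivAt_const b z)).differentiableAt

lemma fderiv_eq_of_eqOn {f g : X → V} (hU : IsOpen U) (hz : z ∈ U) (h : ∀ w ∈ U, f w = g w) :
    fderiv ℝ f z = fderiv ℝ g z :=
  (Filter.eventuallyEq_of_mem (hU.mem_nhds hz) h).fderiv_eq

end LocalCalculus

/-! ### Horizontal derivatives, curvature and energy in coordinates -/

section LocalSpray

variable {E : Type*} [NormedAddCommGroup E] [NormedSpace ℝ E]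
variable {U : Set (E × E)} {z : E × E} {G : E × E → E}

lemma hasFDerivAt_horLift (hG : ContDiffOn ℝ 2 G U) (hU : IsOpen U) (hz : z ∈ U) (a : E) :
    HasFDerivAt (fun w => horLift G w a)
      ((0 : E × E →L[ℝ] E).prod (-(fderiv ℝ (fderiv ℝ G) z).flip ((0 : E), a))) z := by
  have h := hasFDerivAt_fderiv_apply hG hU hz (hasFDerivAt_const ((0 : E), a) z)
  rw [ContinuousLinearMap.comp_zero, zero_add] at h
  exact (hasFDerivAt_const a z).prodMk h.neg

/-- The lift varies with the point, which produces the term in the second derivative of `G`.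
Antisymmetrized, these terms form the curvature. -/
lemma fderiv_apply_horLift {f : E × E → ℝ} (hf : ContDiffOn ℝ 2 f U)
    (hG : ContDiffOn ℝ 2 G U) (hU : IsOpen U) (hz : z ∈ U) (a : E) (x : E × E) :
    fderiv ℝ (fun w => fderiv ℝ f w (horLift G w a)) z x =
      fderiv ℝ (fderiv ℝ f) z x (horLift G z a)
        - fderiv ℝ f z ((0 : E), fderiv ℝ (fderiv ℝ G) z x ((0 : E), a)) := by
  rw [(hasFDerivAt_fderiv_apply hf hU hz (hasFDerivAt_horLift hG hU hz a)).fderiv]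
  have h : ((0 : E), -fderiv ℝ (fderiv ℝ G) z x ((0 : E), a))
      = -((0 : E), fderiv ℝ (fderiv ℝ G) z x ((0 : E), a)) := by simp
  change fderiv ℝ f z ((0 : E), -fderiv ℝ (fderiv ℝ G) z x ((0 : E), a))
    + fderiv ℝ (fderiv ℝ f) z x (horLift G z a) = _
  rw [h, map_neg]
  ring

/-- The Ricci identity: the horizontal derivatives commute up to the curvature. -/
lemma fderiv_connCurvature {f : E × E → ℝ} (hf : ContDiffOn ℝ 2 f U)
    (hG : ContDiffOn ℝ 2 G U) (hU : IsOpen U) (hz : z ∈ U) (a b : E) :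
    fderiv ℝ f z ((0 : E), connCurvature G z a b) =
      fderiv ℝ (fun w => fderiv ℝ f w (horLift G w a)) z (horLift G z b)
        - fderiv ℝ (fun w => fderiv ℝ f w (horLift G w b)) z (horLift G z a) := by
  rw [fderiv_apply_horLift hf hG hU hz, fderiv_apply_horLift hf hG hU hz,
    fderiv_fderiv_comm hf hU hz (horLift G z b)]
  have : ((0 : E), connCurvature G z a b) =
      ((0 : E), fderiv ℝ (fderiv ℝ G) z (horLift G z a) ((0 : E), b))
        - ((0 : E), fderiv ℝ (fderiv ℝ G) z (horLift G z b) ((0 : E), a)) := by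
    simp [connCurvature]
  rw [this, map_sub]
  ring

/-- The energy of a Finsler function is constant along the horizontal directions of its geodesic
spray. -/
lemma fderiv_energy_horLift {L : E × E → ℝ} (hL : ContDiffOn ℝ 2 L U) (hG : ContDiffOn ℝ 2 G U)
    (hU : IsOpen U) (heuler : ∀ w ∈ U, fderiv ℝ L w ((0 : E), w.2) = 2 * L w)
    (hgeod : ∀ w ∈ U, ∀ Z : E × E,
      extD (dJ L) w (w.2, (-2 : ℝ) • G w) Z = -fderiv ℝ L w Z) (hz : z ∈ U) (a : E) :
    fderiv ℝ L z (horLift G z a) = 0 := by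
  have hext : ∀ w ∈ U, ∀ x y : E × E, extD (dJ L) w x y =
      fderiv ℝ (fderiv ℝ L) w x (0, y.1) - fderiv ℝ (fderiv ℝ L) w y (0, x.1) := by
    intro w hw x y
    have h := (differentiableAt_fderiv_of_contDiffOn hL hU hw).hasFDerivAt.clm_comp
      (hasFDerivAt_const ((ContinuousLinearMap.inr ℝ E E).comp (ContinuousLinearMap.fst ℝ E E)) w)
    have h' : fderiv ℝ (dJ L) w = _ := h.fderiv
    simp [extD, h']
  -- Euler's relation differentiated; the last term arises because the direction `(0, y)` moves with
  -- the point.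
  have hD2 : ∀ w ∈ U, ∀ x : E × E, fderiv ℝ (fderiv ℝ L) w x (0, w.2) =
      2 * fderiv ℝ L w x - fderiv ℝ L w (0, x.2) := by
    intro w hw x
    have h := hasFDerivAt_fderiv_apply hL hU hw
      ((hasFDerivAt_const (0 : E) w).prodMk (hasFDerivAt_snd (𝕜 := ℝ) (p := w)))
    have h1 := congrArg (fun A : E × E →L[ℝ] ℝ => A x) (fderiv_eq_of_eqOn hU hw heuler)
    simp only [h.fderiv] at h1
    rw [((differentiableAt_of_contDiffOn hL hU hw).hasFDerivAt.const_mul 2).fderiv] at h1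
    simp at h1
    linarith
  -- The Euler–Lagrange equation `S(∂L/∂y^b) = ∂L/∂x^b`. Taking `b = y` next yields `S(L) = 0`,
  -- whose vertical derivative along `a` gives the claim.
  have hEL : ∀ w ∈ U, ∀ b : E, fderiv ℝ (fderiv ℝ L) w (w.2, (-2 : ℝ) • G w) (0, b)
      = fderiv ℝ L w (b, 0) := by
    intro w hw b
    have h1 := hgeod w hw (b, 0)
    rw [hext w hw, hD2 w hw] at h1
    have : (((0 : E), (0 : E))) = 0 := rfl
    simp [this] at h1 ⊢
    linarith
  have hS : ∀ w ∈ U, fderiv ℝ L w (w.2, (-2 : ℝ) • G w) = 0 := by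
    intro w hw
    have h1 := hEL w hw w.2
    rw [hD2 w hw] at h1
    have h2 : ((w.2, (-2 : ℝ) • G w) : E × E) = (w.2, 0) + (0, (-2 : ℝ) • G w) := by simp
    rw [h2, map_add] at h1 ⊢
    simp only [Prod.snd_add, zero_add] at h1
    linarith
  have hc := (hasFDerivAt_snd (𝕜 := ℝ) (p := z)).prodMk
    ((differentiableAt_of_contDiffOn hG hU hz).hasFDerivAt.const_smul (-2 : ℝ))
  have h := hasFDerivAt_fderiv_apply hL hU hz hc
  have h1 := congrArg (fun A : E × E →L[ℝ] ℝ => A ((0 : E), a)) (fderiv_eq_of_eqOn hU hz hS)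
  erw [h.fderiv] at h1
  simp only [fderiv_fun_const] at h1
  simp only [_root_.add_apply, ContinuousLinearMap.comp_apply,
    ContinuousLinearMap.flip_apply, ContinuousLinearMap.prod_apply,
    ContinuousLinearMap.coe_snd', _root_.smul_apply, Pi.zero_apply,
    _root_.zero_apply] at h1
  have h3 := hEL z hz a
  rw [fderiv_fderiv_comm hL hU hz] at h1
  have h4 : ((a, (-2 : ℝ) • fderiv ℝ G z (0, a)) : E × E)
      = (2 : ℝ) • horLift G z a - (a, 0) := by
    ext
    · simp [horLift, two_smul]
    · simp [horLift]
  rw [h4, map_sub, map_smul, smul_eq_mul, Pi.smul_apply] at h1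
  have h5 := fderiv_fderiv_comm hL hU hz ((0 : E), a) (z.2, (-2 : ℝ) • G z)
  linarith

variable {P u : E × E → ℝ} {l : ℝ}

/-- The vertical differential of `u` is an eigenvector of the transposed Jacobi endomorphism. -/
lemma fderiv_jacobi_eq (hU : IsOpen U) (hG : ContDiffOn ℝ 2 G U) (hP : ContDiffOn ℝ 2 P U)
    (hu : ContDiffOn ℝ 2 u U) (hPhor : ∀ w ∈ U, ∀ a, fderiv ℝ P w (horLift G w a) = 0)
    (huhor : ∀ w ∈ U, ∀ a, fderiv ℝ u w (horLift G w a) =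
      l * (P w * fderiv ℝ u w (0, a) + 2 * fderiv ℝ P w (0, a)))
    (hPy : ∀ w ∈ U, fderiv ℝ P w (0, w.2) = P w) (huy : ∀ w ∈ U, fderiv ℝ u w (0, w.2) = 0)
    (hz : z ∈ U) (b : E) :
    fderiv ℝ u z (0, connCurvature G z z.2 b) = l ^ 2 * P z ^ 2 * fderiv ℝ u z (0, b) := by
  have key : ∀ (a : E) (x : E × E),
      fderiv ℝ (fun w => fderiv ℝ u w (horLift G w a)) z x =
      l * (fderiv ℝ P z x * fderiv ℝ u z (0, a) + P z * fderiv ℝ (fderiv ℝ u) z x (0, a)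
        + 2 * fderiv ℝ (fderiv ℝ P) z x (0, a)) := by
    intro a x
    rw [fderiv_eq_of_eqOn hU hz (fun w hw => huhor w hw a)]
    have h1 := (differentiableAt_of_contDiffOn hP hU hz).hasFDerivAt.mul
      (differentiableAt_fderiv_const_apply hu hU hz ((0 : E), a)).hasFDerivAt
    have h2 := (differentiableAt_fderiv_const_apply hP hU hz ((0 : E), a)).hasFDerivAt.const_mul 2
    have h3 := (h1.add h2).const_mul l
    erw [h3.fderiv]
    simp [fderiv_fderiv_const_apply hP hU hz, fderiv_fderiv_const_apply hu hU hz]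
    ring
  have hPP : ∀ (a b : E), fderiv ℝ (fderiv ℝ P) z (horLift G z a) (0, b) =
      fderiv ℝ P z ((0 : E), fderiv ℝ (fderiv ℝ G) z (0, b) ((0 : E), a)) := by
    intro a b
    have h1 := fderiv_apply_horLift hP hG hU hz a ((0 : E), b)
    rw [fderiv_eq_of_eqOn hU hz (fun w hw => hPhor w hw a), fderiv_fderiv_comm hP hU hz] at h1
    simp at h1
    linarith
  have huu : ∀ (a b : E), fderiv ℝ (fderiv ℝ u) z (horLift G z a) (0, b) =
      fderiv ℝ u z ((0 : E), fderiv ℝ (fderiv ℝ G) z (0, b) ((0 : E), a)) +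
      l * (fderiv ℝ P z (0, b) * fderiv ℝ u z (0, a)
        + P z * fderiv ℝ (fderiv ℝ u) z (0, b) (0, a)
        + 2 * fderiv ℝ (fderiv ℝ P) z (0, b) (0, a)) := by
    intro a b
    have h1 := fderiv_apply_horLift hu hG hU hz a ((0 : E), b)
    rw [key, fderiv_fderiv_comm hu hU hz (0, b) (horLift G z a)] at h1
    linarith
  -- With `a = y` frozen at `z`, all terms symmetric in `a, b` cancel, leaving `l² P (∂_a P ∂_b u -
  -- ∂_b P ∂_a u)`. Euler's relations `∂_y P = P` and `∂_y u = 0` finish.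
  have h := fderiv_connCurvature hu hG hU hz z.2 b
  rw [key, key, hPhor z hz, hPhor z hz, huu, huu, hPP, hPP, hPy z hz, huy z hz,
    fderiv_fderiv_comm hG hU hz (0, z.2) (0, b), fderiv_fderiv_comm hu hU hz (0, z.2) (0, b),
    fderiv_fderiv_comm hP hU hz (0, z.2) (0, b)] at h
  rw [h]
  ring

/-- If `u` depends on the base point only, then `P` is affine along the fibres. -/
lemma fderiv_fderiv_vertical_eq_zero (hU : IsOpen U) (hP : ContDiffOn ℝ 2 P U)
    (hu : ContDiffOn ℝ 2 u U)
    (huhor : ∀ w ∈ U, ∀ a, fderiv ℝ u w (horLift G w a) =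
      l * (P w * fderiv ℝ u w (0, a) + 2 * fderiv ℝ P w (0, a)))
    (huv : ∀ w ∈ U, ∀ a, fderiv ℝ u w (0, a) = 0) (hl : l ≠ 0) (hz : z ∈ U) (a b : E) :
    fderiv ℝ (fderiv ℝ P) z (0, a) (0, b) = 0 := by
  have h0 : ∀ w ∈ U, fderiv ℝ u w (b, 0) = 2 * l * fderiv ℝ P w (0, b) := by
    intro w hw
    have h := huhor w hw b
    have h2 : horLift G w b = (b, 0) + (0, -fderiv ℝ G w (0, b)) := by simp [horLift]
    rw [h2, map_add, huv w hw, huv w hw] at h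
    linarith
  have h1 := congrArg (fun A : E × E →L[ℝ] ℝ => A ((0 : E), a)) (fderiv_eq_of_eqOn hU hz h0)
  have h2 := congrArg (fun A : E × E →L[ℝ] ℝ => A (b, (0 : E)))
    (fderiv_eq_of_eqOn hU hz (fun w hw => huv w hw a))
  have h3 := (differentiableAt_fderiv_const_apply hP hU hz ((0 : E), b)).hasFDerivAt.const_mul
    (2 * l)
  simp only [fderiv_fderiv_const_apply hu hU hz, h3.fderiv, _root_.smul_apply,
    fderiv_fderiv_const_apply hP hU hz, fderiv_fun_const, Pi.zero_apply,
    _root_.zero_apply, smul_eq_mul] at h1 h2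
  -- The mixed derivative of `u` vanishes because its vertical derivatives do; by `h0` it is also `2
  -- l` times the fibre Hessian of `P`.
  rw [fderiv_fderiv_comm hu hU hz, h2] at h1
  simpa [hl] using h1.symm

/-- If the energy is, along the fibres, proportional to the square of a function that is affine
along the fibres, then the metric tensor is degenerate. -/
lemma fderiv_fderiv_energy_eq_zero {L : E × E → ℝ} (hU : IsOpen U) (hP : ContDiffOn ℝ 2 P U)
    (hL : ContDiffOn ℝ 2 L U) (hP0 : ∀ w ∈ U, P w ≠ 0)
    (hLP : ∀ w ∈ U, ∀ a, P w * fderiv ℝ L w (0, a) = 2 * L w * fderiv ℝ P w (0, a)) (hz : z ∈ U)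
    (hPv : ∀ a b, fderiv ℝ (fderiv ℝ P) z (0, a) (0, b) = 0) {a : E}
    (ha : fderiv ℝ P z (0, a) = 0) (b : E) :
    fderiv ℝ (fderiv ℝ L) z (0, a) (0, b) = 0 := by
  have h := congrArg (fun A : E × E →L[ℝ] ℝ => A ((0 : E), a))
    (fderiv_eq_of_eqOn hU hz (fun w hw => hLP w hw b))
  have h1 := (differentiableAt_of_contDiffOn hP hU hz).hasFDerivAt.mul
    (differentiableAt_fderiv_const_apply hL hU hz ((0 : E), b)).hasFDerivAt
  have h2 := ((differentiableAt_of_contDiffOn hL hU hz).hasFDerivAt.const_mul 2).mul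
    (differentiableAt_fderiv_const_apply hP hU hz ((0 : E), b)).hasFDerivAt
  have h3 := hLP z hz a
  erw [h1.fderiv, h2.fderiv] at h
  have ha' : fderiv ℝ L z (0, a) = 0 := by
    rw [ha, mul_zero] at h3
    exact (mul_eq_zero.1 h3).resolve_left (hP0 z hz)
  simpa [fderiv_fderiv_const_apply hL hU hz, fderiv_fderiv_const_apply hP hU hz, ha, ha', hPv,
    hP0 z hz] using h

end LocalSpray

/-! ### The local theorem: countably many exceptional parameters -/

section LocalMetrizability

variable {E : Type*} [NormedAddCommGroup E] [NormedSpace ℝ E]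
variable {U : Set (E × E)} {z : E × E} {G : E × E → E} {P : E × E → ℝ} {l : ℝ}

/-- The Jacobi endomorphism of the spray with coefficients `G`. -/
def jacobiEndo (G : E × E → E) (z : E × E) : E →ₗ[ℝ] E where
  toFun b := connCurvature G z z.2 b
  map_add' b c := by
    have h1 : ((0 : E), b + c) = (0, b) + (0, c) := by simp
    have h2 : horLift G z (b + c) = horLift G z b + horLift G z c := by
      simp only [horLift]
      rw [h1, map_add, neg_add, Prod.mk_add_mk]
    simp only [connCurvature, h1, h2, map_add, _root_.add_apply]
    abel
  map_smul' r b := by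
    have h1 : ((0 : E), r • b) = r • (0, b) := by simp
    have h2 : horLift G z (r • b) = r • horLift G z b := by
      simp only [horLift]
      rw [h1, map_smul, ← smul_neg, Prod.smul_mk]
    simp only [connCurvature, h1, h2, map_smul, _root_.smul_apply, smul_sub, RingHom.id_apply]

/-- There are finitely many eigenvalues `μ`, and each comes from at most the two parameters `±√(μ /
p²)`. -/
lemma countable_setOf_eigenvalue [FiniteDimensional ℝ E] {p : ℝ} (hp : p ≠ 0) :
    {l : ℝ | Module.End.HasEigenvalue (jacobiEndo G z).dualMap (l ^ 2 * p ^ 2)}.Countable := by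
  have hfin := Module.End.finite_hasEigenvalue (jacobiEndo G z).dualMap
  have hsub : {l : ℝ | Module.End.HasEigenvalue (jacobiEndo G z).dualMap (l ^ 2 * p ^ 2)} ⊆
      ⋃ μ ∈ {μ | Module.End.HasEigenvalue (jacobiEndo G z).dualMap μ},
        {√(μ / p ^ 2), -√(μ / p ^ 2)} := by
    intro l hl
    refine mem_biUnion (x := l ^ 2 * p ^ 2) hl ?_
    rw [mul_div_cancel_right₀ _ (pow_ne_zero 2 hp), Real.sqrt_sq_eq_abs]
    rcases abs_choice l with h | h <;> simp [h]
  exact (hfin.countable.biUnion fun μ _ => (toFinite _).countable).mono hsub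

/-- The lift for `G + l P y` is `δ_a - l P ∂_a - l (∂_a P) C`, with `C` the Liouville field. It
kills `L`, and `C L = 2 L`. -/
lemma fderiv_deform_horLift {L : E × E → ℝ} (hU : IsOpen U) (hG : ContDiffOn ℝ 2 G U)
    (hP : ContDiffOn ℝ 2 P U) (hL : ContDiffOn ℝ 2 L U)
    (heuler : ∀ w ∈ U, fderiv ℝ L w ((0 : E), w.2) = 2 * L w)
    (hgeod : ∀ w ∈ U, ∀ Z : E × E,
      extD (dJ L) w (w.2, (-2 : ℝ) • (G w + (l * P w) • w.2)) Z = -fderiv ℝ L w Z)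
    (hz : z ∈ U) (a : E) :
    fderiv ℝ L z (horLift G z a) =
      l * (P z * fderiv ℝ L z (0, a) + 2 * L z * fderiv ℝ P z (0, a)) := by
  have hG' : ContDiffOn ℝ 2 (fun w => G w + (l * P w) • w.2) U :=
    hG.add ((contDiffOn_const.mul hP).smul contDiffOn_snd)
  have h := fderiv_energy_horLift hL hG' hU heuler hgeod hz a
  have hd := (differentiableAt_of_contDiffOn hG hU hz).hasFDerivAt.add
    (((differentiableAt_of_contDiffOn hP hU hz).hasFDerivAt.const_mul l).smul
      (hasFDerivAt_snd (𝕜 := ℝ) (p := z)))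
  have hd' : fderiv ℝ (fun w => G w + (l * P w) • w.2) z (0, a) = fderiv ℝ G z (0, a) +
      ((l * P z) • a + (l * fderiv ℝ P z (0, a)) • z.2) := by
    erw [hd.fderiv]
    simp
  have hsplit : horLift (fun w => G w + (l * P w) • w.2) z a = horLift G z a
      - (l * P z) • ((0 : E), a) - (l * fderiv ℝ P z (0, a)) • ((0 : E), z.2) := by
    rw [horLift, hd']
    ext
    · simp [horLift]
    · simp only [horLift, Prod.snd_sub, Prod.smul_snd]
      abel
  rw [hsplit, map_sub, map_sub, map_smul, map_smul, heuler z hz, smul_eq_mul, smul_eq_mul] at h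
  linarith

/-- Local form of the theorem: outside a countable set of parameters `l`, the energy of a Finsler
function whose geodesic spray has the coefficients `G + l P y` has a degenerate metric tensor
somewhere. -/
theorem exists_countable_forall_degenerate [FiniteDimensional ℝ E]
    (hdim : 2 ≤ Module.finrank ℝ E) (hU : IsOpen U) (hne : U.Nonempty) (hG : ContDiffOn ℝ 2 G U)
    (hP : ContDiffOn ℝ 2 P U) (hP0 : ∀ w ∈ U, P w ≠ 0)
    (hPhor : ∀ w ∈ U, ∀ a, fderiv ℝ P w (horLift G w a) = 0)
    (hPy : ∀ w ∈ U, fderiv ℝ P w (0, w.2) = P w) :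
    ∃ B : Set ℝ, B.Countable ∧ ∀ l ∉ B, ∀ L : E × E → ℝ, ContDiffOn ℝ 2 L U →
      (∀ w ∈ U, 0 < L w) → (∀ w ∈ U, fderiv ℝ L w ((0 : E), w.2) = 2 * L w) →
      (∀ w ∈ U, ∀ Z : E × E,
        extD (dJ L) w (w.2, (-2 : ℝ) • (G w + (l * P w) • w.2)) Z = -fderiv ℝ L w Z) →
      ∃ z ∈ U, ∃ a : E, a ≠ 0 ∧ ∀ b, fderiv ℝ (fderiv ℝ L) z (0, a) (0, b) = 0 := by
  obtain ⟨D, hDc, hDd⟩ := TopologicalSpace.exists_countable_dense (E × E)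
  -- The value `0` is excluded since the horizontal equation for `u` then says nothing about `P`.
  -- The eigenvalue condition is imposed only at points of the dense set `D`, which keeps the union
  -- countable.
  refine ⟨insert 0 (⋃ w ∈ D ∩ U,
    {l : ℝ | Module.End.HasEigenvalue (jacobiEndo G w).dualMap (l ^ 2 * P w ^ 2)}), ?_, ?_⟩
  · exact ((hDc.mono inter_subset_left).biUnion fun w hw =>
      countable_setOf_eigenvalue (hP0 w hw.2)).insert 0
  intro l hl L hL hLpos heuler hgeod
  rw [mem_insert_iff, not_or] at hl
  obtain ⟨hl0, hl⟩ := hl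
  -- `P` may be negative: `Real.log` is `log |·|`, with the usual derivative away from `0`.
  set u : E × E → ℝ := fun w => (1 / 2) * Real.log (L w) - Real.log (P w)
  have hu : ContDiffOn ℝ 2 u U :=
    (contDiffOn_const.mul (hL.log fun w hw => (hLpos w hw).ne')).sub (hP.log hP0)
  have hdu : ∀ w ∈ U, ∀ x, 2 * L w * P w * fderiv ℝ u w x =
      P w * fderiv ℝ L w x - 2 * L w * fderiv ℝ P w x := by
    intro w hw x
    have h1 := (((differentiableAt_of_contDiffOn hL hU hw).hasFDerivAt.log
      (hLpos w hw).ne').const_mul (1 / 2)).sub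
      ((differentiableAt_of_contDiffOn hP hU hw).hasFDerivAt.log (hP0 w hw))
    have hL0 := (hLpos w hw).ne'
    have hP0' := hP0 w hw
    erw [h1.fderiv]
    simp
    field_simp
  have huhor : ∀ w ∈ U, ∀ a, fderiv ℝ u w (horLift G w a) =
      l * (P w * fderiv ℝ u w (0, a) + 2 * fderiv ℝ P w (0, a)) := by
    intro w hw a
    have h1 := hdu w hw (horLift G w a)
    rw [fderiv_deform_horLift hU hG hP hL heuler hgeod hw a, hPhor w hw] at h1
    have h2 := hdu w hw (0, a)
    apply mul_left_cancel₀ (mul_ne_zero (mul_ne_zero two_ne_zero (hLpos w hw).ne') (hP0 w hw))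
    linear_combination h1 - l * P w * h2
  have huy : ∀ w ∈ U, fderiv ℝ u w (0, w.2) = 0 := by
    intro w hw
    have h1 := hdu w hw (0, w.2)
    rw [heuler w hw, hPy w hw] at h1
    apply mul_left_cancel₀ (mul_ne_zero (mul_ne_zero two_ne_zero (hLpos w hw).ne') (hP0 w hw))
    linear_combination h1
  have huv : ∀ w ∈ U, ∀ a, fderiv ℝ u w (0, a) = 0 := by
    have hdense : ∀ w ∈ D ∩ U, ∀ a, fderiv ℝ u w (0, a) = 0 := by
      intro w hw a
      by_contra hne0
      refine hl (mem_biUnion hw ?_)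
      refine Module.End.hasEigenvalue_of_hasEigenvector
        (x := (((fderiv ℝ u w).comp (ContinuousLinearMap.inr ℝ E E) : E →L[ℝ] ℝ) : E →ₗ[ℝ] ℝ))
        ⟨?_, ?_⟩
      · rw [Module.End.mem_eigenspace_iff]
        ext b
        exact fderiv_jacobi_eq hU hG hP hu hPhor huhor hPy huy hw.2 b
      · intro h0
        exact hne0 (LinearMap.congr_fun h0 a)
    intro w hw a
    have hcont : ContinuousOn (fun w => fderiv ℝ u w (0, a)) U := fun w hw =>
      (differentiableAt_fderiv_const_apply hu hU hw _).continuousAt.continuousWithinAt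
    have hw' : w ∈ closure (D ∩ U) := by
      rw [inter_comm]
      exact (hDd.open_subset_closure_inter hU) hw
    have hcw := (hcont w hw).mono (inter_subset_right (s := D))
    have := hcw.mem_closure hw' (fun x hx => show fderiv ℝ u x (0, a) ∈ ({0} : Set ℝ) from
      hdense x hx a)
    simpa using this
  obtain ⟨z, hz⟩ := hne
  obtain ⟨a, ha, ha0⟩ : ∃ a ∈ LinearMap.ker
      (((fderiv ℝ P z).comp (ContinuousLinearMap.inr ℝ E E) : E →L[ℝ] ℝ) : E →ₗ[ℝ] ℝ), a ≠ 0 := by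
    apply Submodule.exists_mem_ne_zero_of_ne_bot
    -- A single covector on a space of dimension at least 2 has a nonzero kernel; this `a` is the
    -- degenerate direction.
    exact LinearMap.ker_ne_bot_of_finrank_lt (by simpa using Nat.lt_of_succ_le hdim)
  refine ⟨z, hz, a, ha0, fun b => ?_⟩
  refine fderiv_fderiv_energy_eq_zero hU hP hL hP0 ?_ hz
    (fun a b => fderiv_fderiv_vertical_eq_zero hU hP hu huhor huv hl0 hz a b) ha b
  intro w hw a
  have h1 := hdu w hw (0, a)
  rw [huv w hw] at h1
  linarith

end LocalMetrizability

variable {E : Type*} [NormedAddCommGroup E] [NormedSpace ℝ E]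
variable {M : Type*} [TopologicalSpace M] [ChartedSpace E M] [IsManifold 𝓘(ℝ, E) ∞ M]

/-! ### Induced charts of the tangent bundle -/

section InducedChart

variable {p : M} {v : TangentBundle 𝓘(ℝ, E) M}

lemma mem_tchart_source : v ∈ (tchart E p).source ↔ v.1 ∈ (chartAt E p).source := by
  simp [tchart]

lemma tchart_target (p : M) : (tchart E p).target = (chartAt E p).target ×ˢ univ := by
  ext v
  rw [tchart, extChartAt_target, mem_prod]
  simp only [mem_univ, and_true]
  have h := TangentBundle.mem_chart_target_iff (I := 𝓘(ℝ, E)) (M := M) v ⟨p, 0⟩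
  rw [← h]
  constructor
  · exact fun h => h.1
  · exact fun h => ⟨h, mem_range_self (f := 𝓘(ℝ, E).tangent) v⟩

lemma isOpen_tchart_target (p : M) : IsOpen (tchart E p).target := by
  rw [tchart_target]
  exact (chartAt E p).open_target.prod isOpen_univ

/-- The differential of the chart of `M` around `p` at `x`. -/
def baseChartDeriv (E : Type*) [NormedAddCommGroup E] [NormedSpace ℝ E]
    {M : Type*} [TopologicalSpace M] [ChartedSpace E M] [IsManifold 𝓘(ℝ, E) ∞ M] (p x : M) :
    TangentSpace 𝓘(ℝ, E) x →L[ℝ] E :=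
  mfderiv 𝓘(ℝ, E) 𝓘(ℝ, E) (extChartAt 𝓘(ℝ, E) p) x

lemma tchart_apply_snd (hv : v ∈ (tchart E p).source) :
    (tchart E p v).2 = baseChartDeriv E p v.1 v.2 := by
  rw [mem_tchart_source] at hv
  have h : (tchart E p v).2 = (trivializationAt E (TangentSpace 𝓘(ℝ, E) (M := M)) p v).2 := rfl
  have h2 := TangentBundle.continuousLinearMapAt_trivializationAt (𝕜 := ℝ) (I := 𝓘(ℝ, E)) hv
  rw [h, baseChartDeriv, ← h2, Bundle.Trivialization.continuousLinearMapAt_apply,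
    Bundle.Trivialization.linearMapAt_apply, if_pos]
  exact hv

lemma mdifferentiableAt_tchart (hv : v ∈ (tchart E p).source) :
    MDifferentiableAt 𝓘(ℝ, E).tangent 𝓘(ℝ, E × E) (tchart E p) v := by
  rw [tchart, extChartAt_source] at hv
  exact mdifferentiableAt_extChartAt hv

lemma contMDiffOn_tchart_symm (p : M) :
    ContMDiffOn 𝓘(ℝ, E × E) 𝓘(ℝ, E).tangent ∞ (tchart E p).symm (tchart E p).target :=
  contMDiffOn_extChartAt_symm _

/-- Induced charts are linear on fibres, so homogeneity passes to coordinates. -/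
lemma tchart_symm_smul {z : E × E} (hz : z ∈ (tchart E p).target) (c : ℝ) :
    (tchart E p).symm (z.1, c • z.2) =
      ⟨((tchart E p).symm z).1, c • ((tchart E p).symm z).2⟩ := by
  have hs := (tchart E p).map_target hz
  have hs' : (⟨((tchart E p).symm z).1, c • ((tchart E p).symm z).2⟩ : TangentBundle 𝓘(ℝ, E) M)
      ∈ (tchart E p).source := mem_tchart_source.2 (mem_tchart_source.1 hs)
  have hz' : (z.1, c • z.2) ∈ (tchart E p).target := by
    rw [tchart_target] at hz ⊢
    exact ⟨hz.1, mem_univ _⟩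
  refine (tchart E p).injOn ((tchart E p).map_target hz') hs' ?_
  rw [(tchart E p).right_inv hz']
  have h := (tchart E p).right_inv hz
  refine Prod.ext ?_ ?_
  · exact (congrArg Prod.fst h).symm
  · rw [tchart_apply_snd hs', map_smul, ← tchart_apply_snd hs, h]

lemma tchart_snd_eq_zero_iff (hv : v ∈ (tchart E p).source) :
    (tchart E p v).2 = 0 ↔ v.2 = 0 := by
  constructor
  · intro h
    have hs : (⟨v.1, 0⟩ : TangentBundle 𝓘(ℝ, E) M) ∈ (tchart E p).source :=
      mem_tchart_source.2 (mem_tchart_source.1 hv)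
    have hv0 : v = ⟨v.1, 0⟩ := by
      refine (tchart E p).injOn hv hs (Prod.ext rfl ?_)
      rw [h, tchart_apply_snd hs, map_zero]
    rw [hv0]
  · intro h
    rw [tchart_apply_snd hv, h, map_zero]

lemma components_of_hasDerivAt {γ : ℝ → TangentBundle 𝓘(ℝ, E) M} {t : ℝ} {ξ : E × E}
    (hγ : MDifferentiableAt 𝓘(ℝ, ℝ) 𝓘(ℝ, E).tangent γ t) (hv : γ t = v)
    (hs : v ∈ (tchart E p).source) (h : HasDerivAt (fun s => tchart E p (γ s)) ξ t) :
    components p v ((mfderiv 𝓘(ℝ, ℝ) 𝓘(ℝ, E).tangent γ t : ℝ →L[ℝ] (E × E)) 1) = ξ := by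
  subst hv
  have h1 := mfderiv_comp_apply t (mdifferentiableAt_tchart hs) hγ (1 : ℝ)
  rw [mfderiv_eq_fderiv] at h1
  rw [components]
  refine h1.symm.trans ?_
  exact h.deriv ▸ rfl

lemma components_verticalLift (hv : v ∈ (tchart E p).source) (w : TangentSpace 𝓘(ℝ, E) v.proj) :
    components p v (verticalLift v w) = (0, baseChartDeriv E p v.proj w) := by
  set γ : ℝ → TangentBundle 𝓘(ℝ, E) M := fun t => ⟨v.proj, v.2 + t • w⟩
  have hs : ∀ t, γ t ∈ (tchart E p).source := fun t =>
    mem_tchart_source.2 (mem_tchart_source.1 hv)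
  have hγ : ∀ t, tchart E p (γ t) = ((tchart E p v).1,
      baseChartDeriv E p v.proj v.2 + t • baseChartDeriv E p v.proj w) := by
    intro t
    refine Prod.ext rfl ?_
    rw [tchart_apply_snd (hs t)]
    simp only [γ]
    rw [map_add, map_smul]
  have hd : HasDerivAt (fun t => tchart E p (γ t)) (0, baseChartDeriv E p v.proj w) 0 := by
    simp only [hγ]
    refine (hasDerivAt_const _ _).prodMk ?_
    simpa using ((hasDerivAt_id (0 : ℝ)).smul_const (baseChartDeriv E p v.proj w)).const_add
      (baseChartDeriv E p v.proj v.2)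
  have hγd : MDifferentiableAt 𝓘(ℝ, ℝ) 𝓘(ℝ, E).tangent γ 0 := by
    -- The curve stays in one fibre, hence in the chart domain for all `t`, so its differentiability
    -- can be read off from its affine coordinate expression.
    have h1 : γ = (tchart E p).symm ∘ fun t => tchart E p (γ t) :=
      funext fun t => ((tchart E p).left_inv (hs t)).symm
    rw [h1]
    refine MDifferentiableAt.comp (I' := 𝓘(ℝ, E × E)) 0 ?_ hd.differentiableAt.mdifferentiableAt
    have ht := (tchart E p).map_source (hs 0)
    exact (((contMDiffOn_tchart_symm p).contMDiffAt
      ((isOpen_tchart_target p).mem_nhds ht)).mdifferentiableAt (by simp))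
  exact components_of_hasDerivAt hγd (by simp) hv hd

lemma components_fst (hv : v ∈ (tchart E p).source) (ξ : TangentSpace 𝓘(ℝ, E).tangent v) :
    (components p v ξ).1 = baseChartDeriv E p v.proj
      (mfderiv 𝓘(ℝ, E).tangent 𝓘(ℝ, E) (fun u : TangentBundle 𝓘(ℝ, E) M => u.proj) v ξ) := by
  have hx := mdifferentiableAt_extChartAt (I := 𝓘(ℝ, E)) (mem_tchart_source.1 hv)
  have hp : MDifferentiableAt 𝓘(ℝ, E).tangent 𝓘(ℝ, E)
      (fun u : TangentBundle 𝓘(ℝ, E) M => u.proj) v :=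
    (contMDiff_proj (TangentSpace 𝓘(ℝ, E) (M := M)) (n := ∞) v).mdifferentiableAt (by simp)
  have h1 := mfderiv_comp_apply v hx hp ξ
  have hfst : MDifferentiableAt 𝓘(ℝ, E × E) 𝓘(ℝ, E) (Prod.fst : E × E → E) (tchart E p v) :=
    differentiableAt_fst.mdifferentiableAt
  have h2 := mfderiv_comp_apply v hfst (mdifferentiableAt_tchart hv) ξ
  rw [mfderiv_eq_fderiv, fderiv_fst] at h2
  rw [baseChartDeriv, components]
  exact h2.symm.trans h1

end InducedChart

/-! ### Sprays and homogeneous functions in coordinates -/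

section SprayInCoordinates

variable {p : M} {v : TangentBundle 𝓘(ℝ, E) M} {S : TField E M} {z : E × E}

/-- The image of the slit tangent bundle under the induced chart around `p`. -/
def slitTarget (E : Type*) [NormedAddCommGroup E] [NormedSpace ℝ E]
    {M : Type*} [TopologicalSpace M] [ChartedSpace E M] [IsManifold 𝓘(ℝ, E) ∞ M] (p : M) :
    Set (E × E) :=
  (tchart E p).target ∩ {z | z.2 ≠ 0}

lemma isOpen_slitTarget (p : M) : IsOpen (slitTarget E p) :=
  (isOpen_tchart_target p).inter (isOpen_ne_fun continuous_snd continuous_const)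

lemma tchart_symm_mem_slit (hz : z ∈ slitTarget E p) : (tchart E p).symm z ∈ slit E M := by
  intro h
  rw [← tchart_snd_eq_zero_iff ((tchart E p).map_target hz.1), (tchart E p).right_inv hz.1] at h
  exact hz.2 h

lemma tchart_mem_slitTarget (hv : v ∈ (tchart E p).source) (hs : v ∈ slit E M) :
    tchart E p v ∈ slitTarget E p :=
  ⟨(tchart E p).map_source hv, fun h => hs ((tchart_snd_eq_zero_iff hv).1 h)⟩

lemma components_liouville (hv : v ∈ (tchart E p).source) :
    components p v (liouville v) = (0, (tchart E p v).2) := by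
  rw [liouville, components_verticalLift hv, tchart_apply_snd hv]

lemma components_spray_fst (hS : IsSpray S) (hv : v ∈ (tchart E p).source) (hs : v ∈ slit E M) :
    (components p v (S v)).1 = (tchart E p v).2 := by
  have h := congrArg (components p v) (hS.almostTangent_eq v hs)
  rw [almostTangent, components_verticalLift hv, components_liouville hv] at h
  rw [components_fst hv]
  exact congrArg Prod.snd h

lemma components_projDeform (hv : v ∈ (tchart E p).source)
    (Q : TangentBundle 𝓘(ℝ, E) M → ℝ) :
    components p v (projDeform S Q v) =
      components p v (S v) - (2 * Q v) • (0, (tchart E p v).2) := by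
  rw [← components_liouville hv, projDeform, components, map_sub, map_smul]
  rfl

/-- The deformation amounts to `G ↦ G + Q y`, the form used in the local theorem; `JS = C` fixes the
first component. -/
lemma components_projDeform_eq (hS : IsSpray S) (Q : TangentBundle 𝓘(ℝ, E) M → ℝ)
    (hz : z ∈ slitTarget E p) :
    components p ((tchart E p).symm z) (projDeform S Q ((tchart E p).symm z)) =
      (z.2, (-2 : ℝ) • (sprayCoeff p S z + localFun p Q z • z.2)) := by
  have hs := (tchart E p).map_target hz.1
  have h1 := components_spray_fst hS hs (tchart_symm_mem_slit hz)
  rw [(tchart E p).right_inv hz.1] at h1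
  rw [components_projDeform hs, (tchart E p).right_inv hz.1]
  refine Prod.ext ?_ ?_
  · simp [h1]
  · simp only [sprayCoeff, localFun, Prod.snd_sub, Prod.smul_snd]
    module

lemma contDiffOn_localFun {f : TangentBundle 𝓘(ℝ, E) M → ℝ}
    (hf : ContMDiffOn 𝓘(ℝ, E).tangent 𝓘(ℝ, ℝ) ∞ f (slit E M)) (p : M) :
    ContDiffOn ℝ ∞ (localFun p f) (slitTarget E p) := by
  rw [← contMDiffOn_iff_contDiffOn]
  exact hf.comp ((contMDiffOn_tchart_symm p).mono inter_subset_left)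
    fun z hz => tchart_symm_mem_slit hz

lemma contDiffOn_sprayCoeff (hS : IsSpray S) (p : M) :
    ContDiffOn ℝ ∞ (sprayCoeff p S) (slitTarget E p) := by
  have h := hS.smooth.comp ((contMDiffOn_tchart_symm p).mono inter_subset_left)
    fun z hz => tchart_symm_mem_slit hz
  have hsrc : ∀ z ∈ slitTarget E p,
      (tchart E p).symm z ∈ (chartAt (ModelProd E E) (⟨p, 0⟩ : TangentBundle 𝓘(ℝ, E) M)).source := by
    intro z hz
    have := (tchart E p).map_target hz.1
    rwa [tchart, extChartAt_source] at this
  have hcomp : ContDiffOn ℝ ∞ (fun z => components p ((tchart E p).symm z)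
      (S ((tchart E p).symm z))) (slitTarget E p) := by
    rw [← contMDiffOn_iff_contDiffOn]
    -- Smoothness of `S` as a section is smoothness of its fibre part in the trivialization of
    -- `T(TM)` at `(p, 0)`, and that fibre part is `components p`.
    have h2 := ((trivializationAt (E × E) (TangentSpace 𝓘(ℝ, E).tangent)
      (⟨p, 0⟩ : TangentBundle 𝓘(ℝ, E) M)).contMDiffOn_iff (n := ∞) (IB := 𝓘(ℝ, E).tangent)
      (fun z hz => hsrc z hz)).1 h
    refine h2.2.congr fun z hz => ?_
    have h3 := TangentBundle.continuousLinearMapAt_trivializationAt (𝕜 := ℝ)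
      (I := 𝓘(ℝ, E).tangent) (hsrc z hz)
    refine (DFunLike.congr_fun h3 (S ((tchart E p).symm z))).symm.trans ?_
    rw [Bundle.Trivialization.continuousLinearMapAt_apply,
      Bundle.Trivialization.linearMapAt_apply, if_pos]
    · rfl
    · exact hsrc z hz
  exact contDiffOn_const.smul hcomp.snd

/-- Euler's identity, by differentiating at `c = 1`; used with `k = 1` for `P` and `k = 2` for the
energy. -/
lemma fderiv_of_homogeneous {f : E × E → ℝ} {k : ℕ} (hf : DifferentiableAt ℝ f z)
    (hk : ∀ c : ℝ, 0 < c → f (z.1, c • z.2) = c ^ k * f z) :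
    fderiv ℝ f z (0, z.2) = k * f z := by
  have h1 : HasDerivAt (fun c : ℝ => ((z.1, c • z.2) : E × E)) (0, z.2) 1 :=
    (hasDerivAt_const _ _).prodMk (by simpa using (hasDerivAt_id (1 : ℝ)).smul_const z.2)
  have hz : ((z.1, (1 : ℝ) • z.2) : E × E) = z := by simp
  have h2 : HasDerivAt (fun c : ℝ => f (z.1, c • z.2)) (fderiv ℝ f z (0, z.2)) 1 :=
    HasFDerivAt.comp_hasDerivAt (1 : ℝ) (by rw [hz]; exact hf.hasFDerivAt) h1
  have h3 : HasDerivAt (fun c : ℝ => c ^ k * f z) (k * f z) 1 := by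
    simpa using (hasDerivAt_pow k (1 : ℝ)).mul_const (f z)
  refine h2.unique (h3.congr_of_eventuallyEq ?_)
  filter_upwards [lt_mem_nhds (zero_lt_one' ℝ)] with c hc using hk c hc

lemma localFun_smul (f : TangentBundle 𝓘(ℝ, E) M → ℝ) (hz : z ∈ slitTarget E p) (c : ℝ) :
    localFun p f (z.1, c • z.2) =
      f ⟨((tchart E p).symm z).1, c • ((tchart E p).symm z).2⟩ := by
  rw [localFun, tchart_symm_smul hz.1]

end SprayInCoordinates

/-! ### From holonomy invariance to vanishing horizontal derivatives -/

section Parallel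

variable [CompleteSpace E] {p : M} {S : TField E M} {z : E × E}

/-- A holonomy invariant function is constant along the horizontal directions. -/
lemma fderiv_localFun_horLift_eq_zero (hS : IsSpray S) {P : TangentBundle 𝓘(ℝ, E) M → ℝ}
    (hP : ContMDiffOn 𝓘(ℝ, E).tangent 𝓘(ℝ, ℝ) ∞ P (slit E M)) (hPhol : HolonomyInvariant S P)
    (hz : z ∈ slitTarget E p) (a : E) :
    fderiv ℝ (localFun p P) z (horLift (sprayCoeff p S) z a) = 0 := by
  have hU := isOpen_slitTarget (E := E) p
  have hX : ContDiffOn ℝ ∞ (fun w => horLift (sprayCoeff p S) w a) (slitTarget E p) :=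
    contDiffOn_const.prodMk (((contDiffOn_sprayCoeff hS p).fderiv_of_isOpen hU
      (by simp)).clm_apply contDiffOn_const).neg
  -- An integral curve `α` of the horizontal lift of the constant field `a` is, read in `TM`, a
  -- parallel field along its projection. Invariance makes `P` constant on it, and its velocity at
  -- `0` is the lift at `z`.
  obtain ⟨r, hr, ε, hε, hα⟩ :=
    (((hX.contDiffAt (hU.mem_nhds hz)).of_le (by simp)
      ).exists_forall_mem_closedBall_exists_eq_forall_mem_Ioo_hasDerivAt 0)
  obtain ⟨α, hα0, hα⟩ := hα z (Metric.mem_closedBall_self hr.le)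
  rw [zero_sub, zero_add] at hα
  have hnear : ∀ᶠ t in nhds (0 : ℝ), α t ∈ slitTarget E p ∧ t ∈ Ioo (-ε) ε :=
    ((hα 0 ⟨by linarith, hε⟩).continuousAt.eventually
      (hU.mem_nhds (by rwa [hα0]))).and (Ioo_mem_nhds (by linarith) hε)
  obtain ⟨δ, hδ, hδα⟩ := Metric.eventually_nhds_iff.1 hnear
  have hIcc : ∀ t ∈ Icc (-(δ / 2)) (δ / 2), α t ∈ slitTarget E p ∧ t ∈ Ioo (-ε) ε := by
    intro t ht
    refine hδα ?_
    rw [Real.dist_eq, sub_zero, abs_lt]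
    constructor <;> linarith [ht.1, ht.2]
  have hIoo : Ioo (-(δ / 2)) (δ / 2) ⊆ Icc (-(δ / 2)) (δ / 2) := Ioo_subset_Icc_self
  -- Parallel fields are required to lie over smooth curves, so the ODE solution is bootstrapped to
  -- smoothness, on a closed interval that `α` maps into the slit chart.
  have hαs : ContDiffOn ℝ ∞ α (Icc (-(δ / 2)) (δ / 2)) :=
    ODE.contDiffOn_enat_Icc_of_hasDerivWithinAt (n := ⊤) (u := slitTarget E p)
      (f := fun _ w => horLift (sprayCoeff p S) w a)
      (hX.comp contDiffOn_snd fun x hx => hx.2)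
      (fun t ht => (hα t (hIcc t ht).2).hasDerivWithinAt) (fun t ht => (hIcc t ht).1)
  have hγs : ContMDiffOn 𝓘(ℝ, ℝ) 𝓘(ℝ, E).tangent ∞ (fun t => (tchart E p).symm (α t))
      (Ioo (-(δ / 2)) (δ / 2)) :=
    (contMDiffOn_tchart_symm p).comp (hαs.mono hIoo).contMDiffOn
      fun t ht => (hIcc t (hIoo ht)).1.1
  have hpar : IsParallel S (fun t => (tchart E p).symm (α t)) (-(δ / 2)) (δ / 2) := by
    refine ⟨?_, ?_, ?_, ?_⟩
    · exact (contMDiff_proj (TangentSpace 𝓘(ℝ, E) (M := M))).comp_contMDiffOn hγs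
    · exact fun t ht => (hγs.contMDiffAt (Ioo_mem_nhds ht.1 ht.2)).mdifferentiableAt (by simp)
    · exact fun t ht => tchart_symm_mem_slit (hIcc t (hIoo ht)).1
    · intro t ht
      have hs := (tchart E p).map_target (hIcc t (hIoo ht)).1.1
      refine ⟨p, hs, ?_⟩
      have hd : HasDerivAt (fun s => tchart E p ((tchart E p).symm (α s)))
          (horLift (sprayCoeff p S) (α t) a) t := by
        refine (hα t (hIcc t (hIoo ht)).2).congr_of_eventuallyEq ?_
        filter_upwards [Ioo_mem_nhds ht.1 ht.2] with s hs
        exact (tchart E p).right_inv (hIcc s (hIoo hs)).1.1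
      rw [components_of_hasDerivAt ((hγs.contMDiffAt (Ioo_mem_nhds ht.1 ht.2)).mdifferentiableAt
        (by simp)) rfl hs hd, (tchart E p).right_inv (hIcc t (hIoo ht)).1.1]
      rfl
  have h0 : (0 : ℝ) ∈ Ioo (-(δ / 2)) (δ / 2) := ⟨by linarith, by linarith⟩
  have hconst : (fun t => localFun p P (α t)) =ᶠ[nhds 0] fun _ => localFun p P z := by
    filter_upwards [Ioo_mem_nhds h0.1 h0.2] with t ht
    have := hPhol _ _ _ hpar 0 h0 t ht
    rwa [hα0] at this
  have hPd : DifferentiableAt ℝ (localFun p P) z :=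
    ((contDiffOn_localFun hP p).contDiffAt (hU.mem_nhds hz)).differentiableAt (by simp)
  have hd0 := hα 0 ⟨by linarith, hε⟩
  rw [hα0] at hd0
  have hd : HasDerivAt (fun t => localFun p P (α t))
      (fderiv ℝ (localFun p P) z (horLift (sprayCoeff p S) z a)) 0 :=
    HasFDerivAt.comp_hasDerivAt (l := localFun p P) (0 : ℝ)
      (by rw [hα0]; exact hPd.hasFDerivAt) hd0
  exact hd.unique ((hasDerivAt_const _ _).congr_of_eventuallyEq hconst)

end Parallel

end FinslerSpray

end

/-! ### Reduction of the theorem to one chart -/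

theorem theorem1 {E : Type*} [NormedAddCommGroup E] [NormedSpace ℝ E] [FiniteDimensional ℝ E]
    (hdim : 2 ≤ Module.finrank ℝ E)
    {M : Type*} [TopologicalSpace M] [ChartedSpace E M] [IsManifold 𝓘(ℝ, E) ∞ M]
    (S : FinslerSpray.TField E M) (hS : FinslerSpray.IsSpray S)
    (hSmet : FinslerSpray.FinslerMetrizable S)
    (P : TangentBundle 𝓘(ℝ, E) M → ℝ)
    (hPsmooth : ContMDiffOn 𝓘(ℝ, E).tangent 𝓘(ℝ, ℝ) ∞ P (FinslerSpray.slit E M))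
    (hPhom : ∀ (x : M) (y : TangentSpace 𝓘(ℝ, E) x) (c : ℝ), y ≠ 0 → 0 < c →
      P ⟨x, c • y⟩ = c * P ⟨x, y⟩)
    (hPhol : FinslerSpray.HolonomyInvariant S P)
    (hPnontrivial : ∃ v ∈ FinslerSpray.slit E M, P v ≠ 0) :
    ∀ᵐ l : ℝ ∂(volume : Measure ℝ),
      ¬ FinslerSpray.FinslerMetrizable (FinslerSpray.projDeform S (fun v => l * P v)) := by
  open FinslerSpray in
  have : CompleteSpace E := FiniteDimensional.complete ℝ E
  obtain ⟨v₀, hv₀, hPv₀⟩ := hPnontrivial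
  set p : M := v₀.proj
  have hv₀s : v₀ ∈ (tchart E p).source := mem_tchart_source.2 (mem_chart_source E p)
  -- `P` must not vanish on `U`, so that `log |P|` is smooth there and `l² P²` determines `l` up to
  -- sign.
  set U : Set (E × E) := slitTarget E p ∩ localFun p P ⁻¹' {0}ᶜ
  have hPU : ContDiffOn ℝ ∞ (localFun p P) (slitTarget E p) := contDiffOn_localFun hPsmooth p
  have hU : IsOpen U :=
    hPU.continuousOn.isOpen_inter_preimage (isOpen_slitTarget p) isOpen_compl_singleton
  have hUs : U ⊆ slitTarget E p := inter_subset_left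
  have hne : U.Nonempty := ⟨tchart E p v₀, tchart_mem_slitTarget hv₀s hv₀, by
    simpa [localFun, (tchart E p).left_inv hv₀s] using hPv₀⟩
  have h2 : (2 : WithTop ℕ∞) ≤ ∞ := ENat.LEInfty.out
  obtain ⟨B, hB, hdeg⟩ := exists_countable_forall_degenerate (G := sprayCoeff p S)
    (P := localFun p P) hdim hU hne (((contDiffOn_sprayCoeff hS p).mono hUs).of_le h2)
    ((hPU.mono hUs).of_le h2) (fun w hw => hw.2)
    (fun w hw a => fderiv_localFun_horLift_eq_zero hS hPsmooth hPhol (hUs hw) a)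
    (fun w hw => by
      have h := fderiv_of_homogeneous (k := 1)
        (differentiableAt_of_contDiffOn ((hPU.mono hUs).of_le h2) hU hw) (fun c hc => by
          rw [localFun_smul P (hUs hw), hPhom _ _ c (tchart_symm_mem_slit (hUs hw)) hc, pow_one]
          rfl)
      simpa using h)
  rw [ae_iff]
  refine measure_mono_null (t := B) (fun l hl => ?_) (hB.measure_zero _)
  by_contra hlB
  rw [mem_ofPred_eq, not_not] at hl
  obtain ⟨F, hF, hFS⟩ := hl
  have henergy : ContMDiffOn 𝓘(ℝ, E).tangent 𝓘(ℝ, ℝ) ∞ (energy F) (slit E M) :=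
    contMDiffOn_const.mul (hF.smooth.pow 2)
  have hL : ContDiffOn ℝ 2 (localFun p (energy F)) U :=
    ((contDiffOn_localFun henergy p).mono hUs).of_le h2
  obtain ⟨z, hz, a, ha, hdega⟩ := hdeg l hlB (localFun p (energy F)) hL
    (fun w hw => by
      have := hF.pos _ (tchart_symm_mem_slit (hUs hw))
      simp only [localFun, energy]
      positivity)
    (fun w hw => by
      have h := fderiv_of_homogeneous (k := 2) (differentiableAt_of_contDiffOn hL hU hw)
        (fun c hc => by
          rw [localFun_smul _ (hUs hw), energy, hF.homogeneous _ _ c hc, localFun, energy]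
          ring)
      simpa using h)
    (fun w hw Z => by
      have hs := (tchart E p).map_target (hUs hw).1
      have h := hFS p _ hs (tchart_symm_mem_slit (hUs hw)) Z
      rwa [components_projDeform_eq hS _ (hUs hw), (tchart E p).right_inv (hUs hw).1] at h)
  have hs := (tchart E p).map_target (hUs hz).1
  refine ha (hF.nondegenerate p _ hs (tchart_symm_mem_slit (hUs hz)) a fun b => ?_)
  rw [metricTensor, (tchart E p).right_inv (hUs hz).1]
  exact hdega b
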